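/- **Theorem (Kronecker's formula for $g_n$).** For real $n>0$ let $$g_n := 2^{-1/4}\, e^{\pi\sqrt n/24}\prod_{k=0}^{\infty}\bigl(1-e^{-(2k+1)\pi\sqrt n}\bigr)$$ be Ramanujan's function. Let $A$ and $C$ be real numbers such that the binary quadratic forms $AX^2+2CY^2$ and $2AX^2+CY^2$ are positive definite (that is, $A>0$ and $C>0$), and let $m=2AC$ be their common determinant (the determinant of $aX^2+2bXY+cY^2$ being $ac-b^2$). For real $s>1$ the two sums below, taken over all pairs of integers $(X,Y)\neq(0,0)$, converge absolutely; the product defining $g_{m/A^2}$ converges and $g_{m/A^2}>0$; and $$\lim_{s\to 1^+}\left\{\sum_{(X,Y)\ne(0,0)}\frac{1}{(AX^2+2CY^2)^s}-\sum_{(X,Y)\ne(0,0)}\frac{1}{(2AX^2+CY^2)^s}\right\} =\frac{4\pi}{\sqrt m}\,\ln g_{m/A^2}.\tag{G}$$ -/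

import Mathlib

noncomputable section

/-- A Gauss form `(A, B, C)`: the real binary quadratic form `A X² + 2 B X Y + C Y²`. -/
structure GaussForm where
  A : ℝ
  B : ℝ
  C : ℝ

namespace GaussForm

/-- The value `A X² + 2 B X Y + C Y²` of the form at integers `X`, `Y`. -/
def eval (Q : GaussForm) (X Y : ℤ) : ℝ :=
  Q.A * (X : ℝ) ^ 2 + 2 * Q.B * (X : ℝ) * (Y : ℝ) + Q.C * (Y : ℝ) ^ 2

/-- The determinant `A C - B²` of the form. -/
def det (Q : GaussForm) : ℝ := Q.A * Q.C - Q.B ^ 2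

/-- The form is positive definite: `A > 0`, `C > 0` and `A C - B² > 0`. -/
def PosDef (Q : GaussForm) : Prop := 0 < Q.A ∧ 0 < Q.C ∧ 0 < Q.det

/-- The term `1 / Q(X, Y) ^ s` of the Epstein zeta sum, indexed by the pairs of integers
`(X, Y) ≠ (0, 0)`. -/
def zetaTerm (Q : GaussForm) (s : ℝ) (p : {p : ℤ × ℤ // p ≠ (0, 0)}) : ℝ :=
  1 / (Q.eval p.1.1 p.1.2) ^ s

/-- The Epstein zeta sum `∑' 1 / Q(X, Y) ^ s` over all pairs of integers `(X, Y) ≠ (0, 0)`. -/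
def epsteinZeta (Q : GaussForm) (s : ℝ) : ℝ :=
  ∑' p : {p : ℤ × ℤ // p ≠ (0, 0)}, Q.zetaTerm s p

end GaussForm

/-- The factor `1 - e^{-(2k+1) π √n}` of the product that defines `g_n`, for `k = 0, 1, 2, …`. -/
def ramanujanGFactor (n : ℝ) (k : ℕ) : ℝ :=
  1 - Real.exp (-((2 * (k : ℝ) + 1) * Real.pi * Real.sqrt n))

/-- Ramanujan's function
`g_n = 2^{-1/4} e^{π √n / 24} (1 - e^{-π √n}) (1 - e^{-3π √n}) (1 - e^{-5π √n}) ⋯`. -/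
def ramanujanG (n : ℝ) : ℝ :=
  (2 : ℝ) ^ (-(1 / 4) : ℝ) * Real.exp (Real.pi * Real.sqrt n / 24) *
    ∏' k : ℕ, ramanujanGFactor n k

end

/-!
The forms are `A (X² + c² Y²)` and `2 A (X² + (c/2)² Y²)` with `c = √n`, `n = m / A²`, and
`A c = √m`. Each zeta function is summed row by row, over `X` for fixed `Y`. The integral test
(`abs_rowRemainder_le`) shows that the sum `∑ 1 / (X² + b²)^s` over a row differs from the integral
`2 b^(1 - 2 s) ∫₀^∞ dx / (1 + x²)^s` by at most `b^(-2 s)`, uniformly in `s ≥ 1`. Hence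
(`epsteinZeta_eq`) the zeta function consists of the row `Y = 0`, of the row integrals, which sum to
a multiple of `ζ(2 s - 1)` and carry the pole, and of a series of remainders whose limit as `s → 1`
may be taken term by term.

* The rows `Y = 0` contribute `ζ(2) / A = π² / (6 A)`, which gives the factor `e^(π √n / 24)`.
* The poles cancel, but the two row integrals differ by the factor `2^(s - 1)`; its derivative times
  the residue leaves `-π log 2 / √m` (`tendsto_pole_part`), which gives the factor `2^(-1/4)`.
* At `s = 1` a remainder is `(2 π / b) / (e^(2 π b) - 1)`, by the partial fractions of the cotangent
  (`rowRemainder_one`). Expanded into geometric series, the remainders of the two forms combine to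
  the double series of `r^((2 k + 1) j) / j`, `r = e^(-π √n)`, which is summed over `j` first to give
  `-∑ log (1 - r^(2 k + 1))` (`hasSum_log_ramanujanGFactor`).
-/

namespace KroneckerLimit

open Filter Topology Set MeasureTheory

/-! ### Sums over a row and their integrals -/

/-- The sum `∑ 1 / (X² + b²)^s` over `X ∈ ℤ`. For `b = 0` the term `X = 0` is `1 / 0 = 0`. -/
noncomputable def rowSum (s b : ℝ) : ℝ := ∑' X : ℤ, 1 / ((X : ℝ) ^ 2 + b ^ 2) ^ s

/-- The integral `∫₀^∞ dx / (1 + x²)^s`. -/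
noncomputable def rowIntegral (s : ℝ) : ℝ := ∫ x in Ioi (0 : ℝ), 1 / (1 + x ^ 2) ^ s

/-- The difference between the sum of `1 / (X² + b²)^s` over `X ∈ ℤ` and the integral of the same
function over the line. -/
noncomputable def rowRemainder (s b : ℝ) : ℝ :=
  rowSum s b - 2 * b ^ (1 - 2 * s) * rowIntegral s

lemma tendsto_one_div_rpow {a : ℝ} (ha : 0 < a) :
    Tendsto (fun s : ℝ => 1 / a ^ s) (𝓝[>] 1) (𝓝 (1 / a)) := by
  have h : Tendsto (fun s : ℝ => 1 / a ^ s) (𝓝 1) (𝓝 (1 / a ^ (1 : ℝ))) :=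
    tendsto_const_nhds.div (Real.continuousAt_const_rpow ha.ne').tendsto (by positivity)
  rw [Real.rpow_one] at h
  exact h.mono_left nhdsWithin_le_nhds

lemma tendsto_rpow_one_sub_two_mul {b : ℝ} (hb : 0 < b) :
    Tendsto (fun s : ℝ => b ^ (1 - 2 * s)) (𝓝[>] 1) (𝓝 b⁻¹) := by
  have hc : Continuous fun s : ℝ => b ^ (1 - 2 * s) :=
    continuous_const.rpow (by fun_prop) fun _ => Or.inl hb.ne'
  have h1 : b ^ (1 - 2 * (1 : ℝ)) = b⁻¹ := by rw [← Real.rpow_neg_one]; norm_num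
  exact h1 ▸ (hc.tendsto 1).mono_left nhdsWithin_le_nhds

lemma summable_one_div_succ_sq : Summable fun n : ℕ => 1 / ((n : ℝ) + 1) ^ 2 := by
  have := (summable_nat_add_iff 1).2 (Real.summable_one_div_nat_pow.2 one_lt_two)
  simpa using this

lemma one_div_sq_add_sq_rpow_le {s : ℝ} (hs : 1 ≤ s) (b : ℝ) (n : ℕ) :
    1 / (((n : ℝ) + 1) ^ 2 + b ^ 2) ^ s ≤ 1 / ((n : ℝ) + 1) ^ 2 := by
  have h1 : (1 : ℝ) ≤ ((n : ℝ) + 1) ^ 2 := by nlinarith [n.cast_nonneg (α := ℝ)]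
  apply one_div_le_one_div_of_le (by positivity)
  calc ((n : ℝ) + 1) ^ 2 ≤ ((n : ℝ) + 1) ^ 2 + b ^ 2 := by nlinarith
    _ ≤ (((n : ℝ) + 1) ^ 2 + b ^ 2) ^ s :=
      Real.self_le_rpow_of_one_le (by nlinarith) hs

lemma summable_half_row {s : ℝ} (hs : 1 ≤ s) (b : ℝ) :
    Summable fun n : ℕ => 1 / (((n : ℝ) + 1) ^ 2 + b ^ 2) ^ s :=
  summable_one_div_succ_sq.of_nonneg_of_le (fun n => by positivity)
    (one_div_sq_add_sq_rpow_le hs b)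

lemma summable_nat_row {s : ℝ} (hs : 1 ≤ s) (b : ℝ) :
    Summable fun n : ℕ => 1 / ((n : ℝ) ^ 2 + b ^ 2) ^ s := by
  rw [← summable_nat_add_iff 1]
  simpa using summable_half_row hs b

lemma summable_row {s : ℝ} (hs : 1 ≤ s) (b : ℝ) :
    Summable fun X : ℤ => 1 / ((X : ℝ) ^ 2 + b ^ 2) ^ s := by
  apply Summable.of_nat_of_neg <;> simpa using summable_nat_row hs b

lemma tsum_int_of_even {f : ℤ → ℝ} (hf : f.Even) (h : Summable f) :
    ∑' n, f n = f 0 + 2 * ∑' n : ℕ, f (n + 1) := by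
  rw [tsum_int_eq_zero_add_two_mul_tsum_pnat hf h,
    tsum_pnat_eq_tsum_succ (f := fun n : ℕ => f n)]
  simp

lemma rowSum_eq {s : ℝ} (hs : 1 ≤ s) (b : ℝ) :
    rowSum s b = 1 / (b ^ 2) ^ s + 2 * ∑' n : ℕ, 1 / (((n : ℝ) + 1) ^ 2 + b ^ 2) ^ s := by
  rw [rowSum, tsum_int_of_even (fun n => by simp) (summable_row hs b)]
  simp

lemma tendsto_rowSum (b : ℝ) : Tendsto (fun s => rowSum s b) (𝓝[>] 1) (𝓝 (rowSum 1 b)) := by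
  have key : ∀ x : ℝ, Tendsto (fun s : ℝ => 1 / (x ^ 2 + b ^ 2) ^ s) (𝓝[>] 1)
      (𝓝 (1 / (x ^ 2 + b ^ 2) ^ (1 : ℝ))) := by
    intro x
    rw [Real.rpow_one]
    rcases (by positivity : 0 ≤ x ^ 2 + b ^ 2).eq_or_lt with h | h
    · -- both sides are the junk value `1 / 0 = 0`
      rw [← h]
      refine tendsto_const_nhds.congr' ?_
      filter_upwards [self_mem_nhdsWithin] with s hs
      rw [Real.zero_rpow (zero_lt_one.trans hs).ne']
    · exact tendsto_one_div_rpow h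
  have h0 := key 0
  simp only [ne_eq, OfNat.ofNat_ne_zero, not_false_eq_true, zero_pow, zero_add] at h0
  have h1 : Tendsto (fun s : ℝ => ∑' n : ℕ, 1 / (((n : ℝ) + 1) ^ 2 + b ^ 2) ^ s) (𝓝[>] 1)
      (𝓝 (∑' n : ℕ, 1 / (((n : ℝ) + 1) ^ 2 + b ^ 2) ^ (1 : ℝ))) := by
    refine tendsto_tsum_of_dominated_convergence summable_one_div_succ_sq (fun n => key _) ?_
    filter_upwards [self_mem_nhdsWithin] with s hs n
    rw [Real.norm_of_nonneg (by positivity)]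
    exact one_div_sq_add_sq_rpow_le (le_of_lt hs) b n
  rw [rowSum_eq le_rfl]
  refine Tendsto.congr' ?_ (h0.add (h1.const_mul 2))
  filter_upwards [self_mem_nhdsWithin] with s hs
  rw [rowSum_eq (le_of_lt hs)]

lemma one_div_one_add_sq_rpow_le {s : ℝ} (hs : 1 ≤ s) (x : ℝ) :
    1 / (1 + x ^ 2) ^ s ≤ (1 + x ^ 2)⁻¹ := by
  rw [← one_div]
  exact one_div_le_one_div_of_le (by positivity)
    (Real.self_le_rpow_of_one_le (by nlinarith) hs)

lemma continuous_one_div_sq_add_sq_rpow (s : ℝ) {b : ℝ} (hb : 0 < b) :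
    Continuous fun x : ℝ => 1 / (x ^ 2 + b ^ 2) ^ s := by
  refine continuous_const.div (Continuous.rpow_const (by fun_prop) fun x => ?_) fun x => ?_
  · exact Or.inl (by positivity)
  · positivity

lemma rowIntegral_one : rowIntegral 1 = Real.pi / 2 := by
  simp [rowIntegral]

lemma tendsto_rowIntegral : Tendsto rowIntegral (𝓝[>] 1) (𝓝 (Real.pi / 2)) := by
  rw [← rowIntegral_one]
  refine tendsto_integral_filter_of_dominated_convergence (fun x => (1 + x ^ 2)⁻¹) ?_ ?_
    integrable_inv_one_add_sq.integrableOn ?_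
  · refine Eventually.of_forall fun s => ?_
    have := continuous_one_div_sq_add_sq_rpow s one_pos
    simp only [one_pow, add_comm _ (1 : ℝ)] at this
    exact this.aestronglyMeasurable
  · filter_upwards [self_mem_nhdsWithin] with s hs
    refine Eventually.of_forall fun x => ?_
    rw [Real.norm_of_nonneg (by positivity)]
    exact one_div_one_add_sq_rpow_le (le_of_lt hs) x
  · refine Eventually.of_forall fun x => ?_
    rw [Real.rpow_one]
    exact tendsto_one_div_rpow (by positivity)

lemma antitoneOn_one_div_sq_add_sq_rpow {s b : ℝ} (hs : 0 ≤ s) (hb : 0 < b) :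
    AntitoneOn (fun x : ℝ => 1 / (x ^ 2 + b ^ 2) ^ s) (Ici 0) := by
  intro x hx y hy hxy
  have hx' : 0 ≤ x := hx
  dsimp only
  gcongr

/-- The substitution `x ↦ b x` brings the integral over a half row to the standard one. -/
lemma integral_one_div_sq_add_sq_rpow (s : ℝ) {b : ℝ} (hb : 0 < b) :
    ∫ x in Ioi (0 : ℝ), 1 / (x ^ 2 + b ^ 2) ^ s = b ^ (1 - 2 * s) * rowIntegral s := by
  have h := integral_comp_mul_left_Ioi' (fun x : ℝ => 1 / (x ^ 2 + b ^ 2) ^ s) 0 hb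
  rw [mul_zero] at h
  rw [← h, rowIntegral, smul_eq_mul, ← integral_const_mul, ← integral_const_mul]
  congr 1
  ext x
  have h1 : (b * x) ^ 2 + b ^ 2 = b ^ 2 * (1 + x ^ 2) := by ring
  rw [h1, Real.mul_rpow (by positivity) (by positivity), ← Real.rpow_natCast b 2,
    ← Real.rpow_mul hb.le, Real.rpow_sub hb, Real.rpow_one]
  push_cast
  field_simp

/-- The sum and the integral of the even unimodal function `x ↦ 1 / (x² + b²)^s` differ by at most
its maximum. -/
lemma abs_rowRemainder_le {s b : ℝ} (hs : 1 ≤ s) (hb : 0 < b) :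
    |rowRemainder s b| ≤ 1 / (b ^ 2) ^ s := by
  have anti := antitoneOn_one_div_sq_add_sq_rpow (s := s) (by linarith) hb
  have hsum := summable_nat_row hs b
  have nonneg : ∀ t ∈ Ioi (0 : ℝ), 0 ≤ 1 / (t ^ 2 + b ^ 2) ^ s := fun t _ => by positivity
  have hint := anti.integrableOn_Ioi_zero_of_summable hsum nonneg
  have lower := anti.integral_le_tsum hsum nonneg
  have upper := anti.tsum_add_one_le_integral hint nonneg
  rw [hsum.tsum_eq_zero_add, integral_one_div_sq_add_sq_rpow s hb] at lower
  rw [integral_one_div_sq_add_sq_rpow s hb] at upper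
  simp only [Nat.cast_zero, Nat.cast_add, Nat.cast_one, ne_eq, OfNat.ofNat_ne_zero,
    not_false_eq_true, zero_pow, zero_add] at lower upper
  rw [rowRemainder, rowSum_eq hs, abs_le]
  constructor <;> linarith

lemma abs_rowRemainder_mul_le {s c : ℝ} (hs : 1 ≤ s) (hc : 0 < c) (j : ℕ) :
    |rowRemainder s (c * (j + 1))| ≤ 1 / (c ^ 2) ^ s * (1 / ((j : ℝ) + 1) ^ 2) := by
  refine (abs_rowRemainder_le hs (by positivity)).trans ?_
  rw [mul_pow, Real.mul_rpow (by positivity) (by positivity), ← one_div_mul_one_div]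
  have h := one_div_sq_add_sq_rpow_le hs 0 j
  simp only [ne_eq, OfNat.ofNat_ne_zero, not_false_eq_true, zero_pow, add_zero] at h
  gcongr

lemma summable_rowRemainder {c s : ℝ} (hc : 0 < c) (hs : 1 ≤ s) :
    Summable fun j : ℕ => rowRemainder s (c * (j + 1)) :=
  Summable.of_norm_bounded (summable_one_div_succ_sq.mul_left _) (abs_rowRemainder_mul_le hs hc)

lemma rowRemainder_one_eq (b : ℝ) : rowRemainder 1 b = rowSum 1 b - 2 * b⁻¹ * (Real.pi / 2) := by
  have h1 : b ^ (1 - 2 * (1 : ℝ)) = b⁻¹ := by rw [← Real.rpow_neg_one]; norm_num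
  rw [rowRemainder, rowIntegral_one, h1]

lemma tendsto_rowRemainder {b : ℝ} (hb : 0 < b) :
    Tendsto (fun s => rowRemainder s b) (𝓝[>] 1) (𝓝 (rowRemainder 1 b)) := by
  rw [rowRemainder_one_eq]
  exact (tendsto_rowSum b).sub
    (((tendsto_rpow_one_sub_two_mul hb).const_mul 2).mul tendsto_rowIntegral)

lemma tendsto_tsum_rowRemainder {c : ℝ} (hc : 0 < c) :
    Tendsto (fun s => ∑' j : ℕ, rowRemainder s (c * (j + 1))) (𝓝[>] 1)
      (𝓝 (∑' j : ℕ, rowRemainder 1 (c * (j + 1)))) := by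
  -- the factor `1 / (c ^ 2) ^ s` of the bound depends on `s`, but stays bounded near `s = 1`
  have hM : ∀ᶠ s in 𝓝[>] (1 : ℝ), 1 / (c ^ 2) ^ s < 1 / c ^ 2 + 1 :=
    (tendsto_one_div_rpow (by positivity)).eventually_lt_const (by linarith)
  refine tendsto_tsum_of_dominated_convergence
    (bound := fun j : ℕ => (1 / c ^ 2 + 1) * (1 / ((j : ℝ) + 1) ^ 2))
    (summable_one_div_succ_sq.mul_left _) (fun j => tendsto_rowRemainder (by positivity)) ?_
  filter_upwards [self_mem_nhdsWithin, hM] with s hs hMs j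
  exact (abs_rowRemainder_mul_le (le_of_lt hs) hc j).trans (by gcongr)

/-! ### Values at `s = 1` -/

lemma rowSum_one_zero : rowSum 1 0 = Real.pi ^ 2 / 3 := by
  have h := hasSum_zeta_two.tsum_eq
  rw [hasSum_zeta_two.summable.tsum_eq_zero_add] at h
  rw [rowSum_eq le_rfl]
  simp at h ⊢
  linarith

/-- The partial fraction expansion of the hyperbolic cotangent, in terms of the remainder. -/
lemma rowRemainder_one {b : ℝ} (hb : 0 < b) :
    rowRemainder 1 b = 2 * Real.pi / b * (1 / (Real.exp (2 * Real.pi * b) - 1)) := by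
  -- the Mittag-Leffler expansion of `π cot (π z)` at `z = i b`
  have hz : (Complex.I * b : ℂ) ∈ Complex.integerComplement :=
    UpperHalfPlane.coe_mem_integerComplement ⟨Complex.I * b, by simpa using hb⟩
  have hcot := cot_series_rep' hz
  have hterm : ∀ n : ℕ, 1 / (Complex.I * b - ((n : ℂ) + 1)) + 1 / (Complex.I * b + ((n : ℂ) + 1))
      = -2 * Complex.I * b * ((1 / (((n : ℝ) + 1) ^ 2 + b ^ 2) : ℝ) : ℂ) := by
    intro n
    have h1 : (Complex.I * b - ((n : ℂ) + 1)) ≠ 0 := fun h => by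
      have := congrArg Complex.im h
      simp at this
      exact hb.ne' this
    have h2 : (Complex.I * b + ((n : ℂ) + 1)) ≠ 0 := fun h => by
      have := congrArg Complex.im h
      simp at this
      exact hb.ne' this
    have h3 : ((n : ℂ) + 1) ^ 2 + (b : ℂ) ^ 2 ≠ 0 := by
      have : (((n : ℝ) + 1) ^ 2 + b ^ 2) ≠ 0 := by positivity
      exact_mod_cast this
    push_cast
    field_simp
    linear_combination (2 * Complex.I * (b : ℂ) ^ 3) * Complex.I_sq
  have hexp : Complex.exp (2 * Real.pi * Complex.I * (Complex.I * b))
      = ((Real.exp (2 * Real.pi * b))⁻¹ : ℝ) := by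
    rw [← Real.exp_neg]
    push_cast
    congr 1
    linear_combination (2 * (Real.pi : ℂ) * b) * Complex.I_sq
  have hE : 1 < Real.exp (2 * Real.pi * b) := Real.one_lt_exp_iff.2 (by positivity)
  simp_rw [hterm] at hcot
  rw [tsum_mul_left, ← Complex.ofReal_tsum, Complex.cot_pi_eq_exp_ratio, hexp] at hcot
  rw [rowRemainder_one_eq, rowSum_eq le_rfl]
  simp only [Real.rpow_one]
  set S := ∑' n : ℕ, 1 / (((n : ℝ) + 1) ^ 2 + b ^ 2)
  set E := Real.exp (2 * Real.pi * b)
  have hE0 : E ≠ 0 := by positivity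
  have hE1 : E - 1 ≠ 0 := by linarith
  have hb0 := hb.ne'
  have hE1' : (E : ℂ) - 1 ≠ 0 := by exact_mod_cast hE1
  have hb0' : (b : ℂ) ≠ 0 := by exact_mod_cast hb0
  have hE0' : (E : ℂ) ≠ 0 := by exact_mod_cast hE0
  -- the expansion, multiplied by `i` to make both sides real
  have hreal : 2 * b * S = Real.pi * ((E + 1) / (E - 1)) - 1 / b := by
    have h4 : ((E : ℂ)⁻¹ + 1) / (Complex.I * (1 - (E : ℂ)⁻¹))
        = -Complex.I * ((E + 1) / (E - 1)) := by
      have : (1 - (E : ℂ)⁻¹) = (E - 1) / E := by field_simp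
      rw [this]
      field_simp
      linear_combination ((1 : ℂ) + E) * Complex.I_sq
    push_cast at hcot
    rw [h4] at hcot
    have h5 : 1 / (Complex.I * b) = -Complex.I * (1 / b) := by
      field_simp
      linear_combination Complex.I_sq
    rw [h5] at hcot
    have h6 : ((2 * b * S : ℝ) : ℂ) = ((Real.pi * ((E + 1) / (E - 1)) - 1 / b : ℝ) : ℂ) := by
      push_cast
      linear_combination -Complex.I * hcot +
        (2 * b * (S : ℂ) - Real.pi * ((E + 1) / (E - 1)) + 1 / b) * Complex.I_sq
    exact_mod_cast h6
  have hS : S = (Real.pi * ((E + 1) / (E - 1)) - 1 / b) / (2 * b) := by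
    rw [← hreal]; field_simp
  rw [hS]
  field_simp
  ring

/-! ### The zeta function of a diagonal form as a sum over rows -/

/-- The quadratic form is at least a multiple of the square of the maximum norm. -/
lemma summable_diagonal {α β s : ℝ} (hα : 0 < α) (hβ : 0 < β) (hs : 1 < s) :
    Summable fun p : ℤ × ℤ => 1 / (α * (p.1 : ℝ) ^ 2 + β * (p.2 : ℝ) ^ 2) ^ s := by
  have h := EisensteinSeries.summable_one_div_norm_rpow (k := 2 * s) (by linarith)
  rw [← (finTwoArrowEquiv ℤ).symm.summable_iff] at h
  refine (h.mul_left (1 / (min α β) ^ s)).of_nonneg_of_le (fun p => by positivity) ?_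
  rintro ⟨X, Y⟩
  have hm : 0 < min α β := lt_min hα hβ
  set x := (finTwoArrowEquiv ℤ).symm (X, Y) with hx
  have hnorm : ‖x‖ ^ 2 ≤ (X : ℝ) ^ 2 + (Y : ℝ) ^ 2 := by
    have h1 : ‖x‖ = max |(X : ℝ)| |(Y : ℝ)| := by
      rw [EisensteinSeries.norm_eq_max_natAbs]
      simp [hx, Nat.cast_natAbs]
    rw [h1]
    rcases max_choice |(X : ℝ)| |(Y : ℝ)| with h | h <;> rw [h, sq_abs] <;> nlinarith
  rcases eq_or_ne x 0 with h0 | h0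
  · have hXY : (X, Y) = (0, 0) := (finTwoArrowEquiv ℤ).symm.injective (by
      rw [← hx, h0]; ext i; fin_cases i <;> rfl)
    obtain ⟨rfl, rfl⟩ := Prod.mk.inj hXY
    have : (0 : ℝ) ^ s = 0 := Real.zero_rpow (by linarith)
    simp only [Int.cast_zero, ne_eq, OfNat.ofNat_ne_zero, not_false_eq_true, zero_pow, mul_zero,
      add_zero, this, div_zero]
    exact mul_nonneg (by positivity) (Real.rpow_nonneg (norm_nonneg _) _)
  · have hx0 : 0 < ‖x‖ := norm_pos_iff.2 h0
    have h2 : ‖x‖ ^ (-(2 * s)) = 1 / (‖x‖ ^ 2) ^ s := by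
      rw [Real.rpow_neg hx0.le, Real.rpow_mul hx0.le, one_div]
      norm_num
    simp only [Function.comp_apply, ← hx, h2, one_div_mul_one_div]
    rw [← Real.mul_rpow hm.le (by positivity)]
    refine one_div_le_one_div_of_le (by positivity) ?_
    refine Real.rpow_le_rpow (by positivity) ?_ (by linarith)
    calc min α β * ‖x‖ ^ 2 ≤ min α β * ((X : ℝ) ^ 2 + (Y : ℝ) ^ 2) := by gcongr
      _ ≤ α * (X : ℝ) ^ 2 + β * (Y : ℝ) ^ 2 := by
        rw [mul_add]
        gcongr
        · exact min_le_left _ _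
        · exact min_le_right _ _

lemma zetaTerm_diagonal (α β s : ℝ) (p : {p : ℤ × ℤ // p ≠ (0, 0)}) :
    (GaussForm.mk α 0 β).zetaTerm s p =
      1 / (α * (p.1.1 : ℝ) ^ 2 + β * (p.1.2 : ℝ) ^ 2) ^ s := by
  simp [GaussForm.zetaTerm, GaussForm.eval]

lemma summable_zetaTerm {α β s : ℝ} (hα : 0 < α) (hβ : 0 < β) (hs : 1 < s) :
    Summable ((GaussForm.mk α 0 β).zetaTerm s) :=
  ((summable_diagonal hα hβ hs).comp_injective Subtype.val_injective).congr fun p =>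
    (zetaTerm_diagonal α β s p).symm

lemma epsteinZeta_eq_tsum_prod {α β s : ℝ} (hs : s ≠ 0) :
    (GaussForm.mk α 0 β).epsteinZeta s =
      ∑' p : ℤ × ℤ, 1 / (α * (p.1 : ℝ) ^ 2 + β * (p.2 : ℝ) ^ 2) ^ s := by
  rw [GaussForm.epsteinZeta]
  simp_rw [zetaTerm_diagonal]
  refine tsum_subtype_eq_of_support_subset (s := {p : ℤ × ℤ | p ≠ (0, 0)})
    (f := fun p : ℤ × ℤ => 1 / (α * (p.1 : ℝ) ^ 2 + β * (p.2 : ℝ) ^ 2) ^ s) ?_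
  -- the term at the origin is `1 / 0 ^ s = 0`
  rintro p hp rfl
  exact hp (by simp [Real.zero_rpow hs])

/-- Every row of the form `α (X² + c² Y²)` is a rescaled standard row. -/
lemma row_term {α c s : ℝ} (hα : 0 < α) (x y : ℝ) :
    1 / (α * x ^ 2 + α * c ^ 2 * y ^ 2) ^ s = 1 / α ^ s * (1 / (x ^ 2 + (c * y) ^ 2) ^ s) := by
  rw [one_div_mul_one_div, ← Real.mul_rpow hα.le (by positivity)]
  ring_nf

lemma epsteinZeta_eq_rows {α c s : ℝ} (hα : 0 < α) (hc : 0 < c) (hs : 1 < s) :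
    (GaussForm.mk α 0 (α * c ^ 2)).epsteinZeta s =
      1 / α ^ s * (rowSum s 0 + 2 * ∑' j : ℕ, rowSum s (c * (j + 1))) := by
  have hsum := summable_diagonal hα (show 0 < α * c ^ 2 by positivity) hs
  simp_rw [row_term hα] at hsum
  have hswap := hsum.prod_symm
  rw [epsteinZeta_eq_tsum_prod (by linarith)]
  simp_rw [row_term hα]
  rw [← (Equiv.prodComm ℤ ℤ).tsum_eq]
  have hrow : ∀ Y : ℤ, ∑' X : ℤ, 1 / α ^ s * (1 / ((X : ℝ) ^ 2 + (c * Y) ^ 2) ^ s)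
      = 1 / α ^ s * rowSum s (c * Y) := fun Y => by rw [tsum_mul_left, rowSum]
  have hrows : Summable fun Y : ℤ => 1 / α ^ s * rowSum s (c * Y) := by
    have := hswap.prod
    simpa only [Prod.swap, hrow] using this
  have h1 := hswap.tsum_prod
  simp only [Prod.swap, hrow] at h1
  simp only [Equiv.prodComm_apply, Prod.swap]
  rw [h1, tsum_int_of_even (fun n => by simp [rowSum]) hrows]
  simp only [Int.cast_zero, mul_zero, Int.cast_add, Int.cast_natCast, Int.cast_one]
  rw [tsum_mul_left]
  ring

/-- The Riemann zeta function at a real argument, as the sum of `1 / j ^ t` over `j ≥ 1`. -/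
noncomputable def realZeta (t : ℝ) : ℝ := ∑' j : ℕ, 1 / ((j : ℝ) + 1) ^ t

lemma realZeta_eq {t : ℝ} (ht : 1 < t) : realZeta t = ∑' n : ℕ, 1 / (n : ℝ) ^ t := by
  rw [(Real.summable_one_div_nat_rpow.2 ht).tsum_eq_zero_add]
  simp [realZeta, Real.zero_rpow (by linarith : t ≠ 0)]

lemma tendsto_mul_realZeta :
    Tendsto (fun s : ℝ => (2 * s - 2) * realZeta (2 * s - 1)) (𝓝[>] 1) (𝓝 1) := by
  have h : Tendsto (fun s : ℝ => 2 * s - 1) (𝓝[>] 1) (𝓝[>] 1) := by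
    have hc : Continuous fun s : ℝ => 2 * s - 1 := by fun_prop
    refine tendsto_nhdsWithin_iff.2 ⟨?_, ?_⟩
    · have := hc.tendsto 1
      norm_num at this
      exact this.mono_left nhdsWithin_le_nhds
    · filter_upwards [self_mem_nhdsWithin] with s hs
      have : (1 : ℝ) < s := hs
      exact show (1 : ℝ) < 2 * s - 1 by linarith
  refine (tendsto_sub_mul_tsum_nat_rpow.comp h).congr' ?_
  filter_upwards [self_mem_nhdsWithin] with s hs
  have : (1 : ℝ) < s := hs
  rw [Function.comp_apply, realZeta_eq (by linarith)]
  ring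

/-- The lattice sum split into the row on the axis, the row integrals, which carry the pole at
`s = 1`, and the remainders. -/
lemma epsteinZeta_eq {α c s : ℝ} (hα : 0 < α) (hc : 0 < c) (hs : 1 < s) :
    (GaussForm.mk α 0 (α * c ^ 2)).epsteinZeta s =
      1 / α ^ s * rowSum s 0
        + 4 * rowIntegral s * realZeta (2 * s - 1) * (1 / α ^ s * c ^ (1 - 2 * s))
        + 2 * (1 / α ^ s * ∑' j : ℕ, rowRemainder s (c * (j + 1))) := by
  have hz : Summable fun j : ℕ => 1 / ((j : ℝ) + 1) ^ (2 * s - 1) := by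
    have := (summable_nat_add_iff 1).2
      (Real.summable_one_div_nat_rpow.2 (by linarith : 1 < 2 * s - 1))
    simpa using this
  have hsplit : ∀ j : ℕ, rowSum s (c * (j + 1)) = rowRemainder s (c * (j + 1))
      + 2 * c ^ (1 - 2 * s) * rowIntegral s * (1 / ((j : ℝ) + 1) ^ (2 * s - 1)) := by
    intro j
    have h1 : ((j : ℝ) + 1) ^ (1 - 2 * s) = 1 / ((j : ℝ) + 1) ^ (2 * s - 1) := by
      rw [one_div, ← Real.rpow_neg (by positivity), neg_sub]
    rw [rowRemainder, Real.mul_rpow hc.le (by positivity), h1]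
    ring
  rw [epsteinZeta_eq_rows hα hc hs]
  simp_rw [hsplit]
  rw [(summable_rowRemainder hc hs.le).tsum_add (hz.mul_left _), tsum_mul_left, ← realZeta]
  ring

/-! ### The polar part -/

/-- The poles at `s = 1` of the zeta functions of the forms `α (X² + c² Y²)` and
`2 α (X² + (c/2)² Y²)` cancel, but because of the factor `2 ^ (s - 1)` between their row integrals
a multiple of `log 2` is left over. -/
lemma tendsto_pole_part {α c : ℝ} (hα : 0 < α) (hc : 0 < c) :
    Tendsto (fun s : ℝ => 4 * rowIntegral s * realZeta (2 * s - 1) *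
        (1 / α ^ s * c ^ (1 - 2 * s) - 1 / (2 * α) ^ s * (c / 2) ^ (1 - 2 * s)))
      (𝓝[>] 1) (𝓝 (-(Real.pi * Real.log 2 / (α * c)))) := by
  have hslope : Tendsto (fun s : ℝ => (1 - (2 : ℝ) ^ (s - 1)) / (2 * s - 2)) (𝓝[>] 1)
      (𝓝 (-(Real.log 2 / 2))) := by
    have hd : HasDerivAt (fun s : ℝ => (2 : ℝ) ^ (s - 1)) (Real.log 2) 1 := by
      have := ((hasDerivAt_id (1 : ℝ)).sub_const 1).const_rpow (two_pos (α := ℝ))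
      simpa using this
    have h := (hasDerivAt_iff_tendsto_slope.1 hd).mono_left
      (nhdsWithin_mono 1 fun x (hx : 1 < x) => hx.ne')
    refine ((h.div_const 2).neg).congr' ?_
    filter_upwards [self_mem_nhdsWithin] with s hs
    have : (1 : ℝ) < s := hs
    have h1 : s - 1 ≠ 0 := by linarith
    have h2 : 2 * s - 2 = 2 * (s - 1) := by ring
    rw [slope_def_field, h2]
    simp only [sub_self, Real.rpow_zero]
    field_simp
    ring
  have hcoef : Tendsto (fun s : ℝ => 1 / α ^ s * c ^ (1 - 2 * s)) (𝓝[>] 1) (𝓝 (1 / (α * c))) := by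
    rw [← one_div_mul_one_div, one_div c]
    exact (tendsto_one_div_rpow hα).mul (tendsto_rpow_one_sub_two_mul hc)
  have h := (((tendsto_rowIntegral.const_mul 4).mul tendsto_mul_realZeta).mul hslope).mul hcoef
  convert h.congr' ?_ using 2
  · field_simp
    ring
  · filter_upwards [self_mem_nhdsWithin] with s hs
    have hs1 : (1 : ℝ) < s := hs
    have h1 : s - 1 ≠ 0 := by linarith
    have h2 : 1 / (2 * α) ^ s * (c / 2) ^ (1 - 2 * s)
        = (2 : ℝ) ^ (s - 1) * (1 / α ^ s * c ^ (1 - 2 * s)) := by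
      have h3 : (2 : ℝ) ^ (s - 1) * (2 ^ s * 2 ^ (1 - 2 * s)) = 1 := by
        rw [← Real.rpow_add two_pos, ← Real.rpow_add two_pos]
        ring_nf
        simp
      rw [Real.mul_rpow two_pos.le hα.le, Real.div_rpow hc.le two_pos.le]
      field_simp
      linear_combination -h3
    rw [h2]
    field_simp

/-! ### The remainders and the product -/

lemma ramanujanGFactor_pos {n : ℝ} (hn : 0 < n) (k : ℕ) : 0 < ramanujanGFactor n k := by
  have : 0 < (2 * (k : ℝ) + 1) * Real.pi * √n := by positivity
  rw [ramanujanGFactor, sub_pos, Real.exp_lt_one_iff]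
  linarith

lemma hasSum_odd_pow {r : ℝ} (hr0 : 0 ≤ r) (hr1 : r < 1) :
    HasSum (fun k : ℕ => r ^ (2 * k + 1)) (r / (1 - r ^ 2)) := by
  have h := (hasSum_geometric_of_lt_one (sq_nonneg r) (by nlinarith)).mul_left r
  rw [← div_eq_mul_inv] at h
  simpa only [pow_succ', pow_mul] using h

/-- The value of the two remainders that a row contributes to the difference of the two forms. -/
lemma rowRemainder_sub_half {b : ℝ} (hb : 0 < b) :
    rowRemainder 1 b - rowRemainder 1 (b / 2) / 2 =
      -(2 * Real.pi / b *
        (Real.exp (-(Real.pi * b)) / (1 - Real.exp (-(Real.pi * b)) ^ 2))) := by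
  have h1 : Real.exp (2 * Real.pi * b) = Real.exp (Real.pi * b) ^ 2 := by
    rw [← Real.exp_nat_mul]; congr 1; push_cast; ring
  have h2 : 2 * Real.pi * (b / 2) = Real.pi * b := by ring
  have hE : 1 < Real.exp (Real.pi * b) := Real.one_lt_exp_iff.2 (by positivity)
  rw [rowRemainder_one hb, rowRemainder_one (half_pos hb), h1, h2, Real.exp_neg]
  set E := Real.exp (Real.pi * b)
  have hE0 : E ≠ 0 := by positivity
  have hE1 : E - 1 ≠ 0 := by linarith
  have hE2 : E + 1 ≠ 0 := by linarith
  have h3 : E ^ 2 - 1 = (E - 1) * (E + 1) := by ring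
  have h4 : 1 - E⁻¹ ^ 2 = (E - 1) * (E + 1) / E ^ 2 := by field_simp; ring
  rw [h3, h4]
  field_simp
  ring

/-- The terms of the double series `∑ r^((2k+1)(j+1)) / (j+1)` with `r = e^(-π c)`; the pair is
`(j, k)`. -/
noncomputable def logTerm (c : ℝ) (p : ℕ × ℕ) : ℝ :=
  Real.exp (-((2 * (p.2 : ℝ) + 1) * Real.pi * c)) ^ (p.1 + 1) / ((p.1 : ℝ) + 1)

/-- What the rows `Y = ±(j + 1)` contribute, up to a factor, to the difference of the two zeta
functions at `s = 1` once the row integrals are removed. -/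
noncomputable def rowDifference (c : ℝ) (j : ℕ) : ℝ :=
  rowRemainder 1 (c * (j + 1)) - rowRemainder 1 (c / 2 * (j + 1)) / 2

lemma summable_rowDifference {c : ℝ} (hc : 0 < c) : Summable (rowDifference c) :=
  (summable_rowRemainder hc le_rfl).sub ((summable_rowRemainder (half_pos hc) le_rfl).div_const 2)

lemma logTerm_nonneg (c : ℝ) : 0 ≤ logTerm c :=
  fun p => div_nonneg (pow_nonneg (Real.exp_pos _).le _) (by positivity)

lemma hasSum_logTerm_right {c : ℝ} (hc : 0 < c) (j : ℕ) :
    HasSum (fun k => logTerm c (j, k)) (-(c / (2 * Real.pi) * rowDifference c j)) := by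
  have hb : 0 < c * ((j : ℝ) + 1) := by positivity
  have hr1 : Real.exp (-(Real.pi * (c * (j + 1)))) < 1 := by
    rw [Real.exp_lt_one_iff, neg_lt_zero]
    positivity
  have h := (hasSum_odd_pow (Real.exp_pos _).le hr1).div_const ((j : ℝ) + 1)
  have hhalf : c / 2 * ((j : ℝ) + 1) = c * (j + 1) / 2 := by ring
  have hval : -(c / (2 * Real.pi) * rowDifference c j) = Real.exp (-(Real.pi * (c * (j + 1)))) /
      (1 - Real.exp (-(Real.pi * (c * (j + 1)))) ^ 2) / ((j : ℝ) + 1) := by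
    rw [rowDifference, hhalf, rowRemainder_sub_half hb]
    have := Real.pi_pos.ne'
    field_simp
  have hfun : (fun k => logTerm c (j, k)) = fun k : ℕ =>
      Real.exp (-(Real.pi * (c * (j + 1)))) ^ (2 * k + 1) / ((j : ℝ) + 1) := by
    ext k
    rw [logTerm, ← Real.exp_nat_mul, ← Real.exp_nat_mul]
    congr 2
    push_cast
    ring
  rw [hval, hfun]
  exact h

lemma hasSum_logTerm_left {n : ℝ} (hn : 0 < n) (k : ℕ) :
    HasSum (fun j => logTerm √n (j, k)) (-Real.log (ramanujanGFactor n k)) := by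
  have h := ramanujanGFactor_pos hn k
  rw [ramanujanGFactor, sub_pos, ← abs_of_pos (Real.exp_pos _)] at h
  have hlog := Real.hasSum_pow_div_log_of_abs_lt_one h
  simpa only [logTerm, ramanujanGFactor] using hlog

lemma hasSum_logTerm {c : ℝ} (hc : 0 < c) :
    HasSum (logTerm c) (-(c / (2 * Real.pi) * ∑' j, rowDifference c j)) := by
  have hF : Summable (logTerm c) := by
    rw [summable_prod_of_nonneg (logTerm_nonneg c)]
    refine ⟨fun j => (hasSum_logTerm_right hc j).summable, ?_⟩
    simp_rw [(hasSum_logTerm_right hc _).tsum_eq]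
    exact ((summable_rowDifference hc).mul_left _).neg
  have htotal : ∑' p, logTerm c p = -(c / (2 * Real.pi) * ∑' j, rowDifference c j) := by
    rw [hF.tsum_prod]
    simp_rw [(hasSum_logTerm_right hc _).tsum_eq]
    rw [tsum_neg, tsum_mul_left]
  rw [← htotal]
  exact hF.hasSum

/-- The logarithm of the product is the double series summed in the other order: its sum over `j`
is the logarithmic series of a factor, its sum over `k` is geometric. -/
lemma hasSum_log_ramanujanGFactor {n : ℝ} (hn : 0 < n) :
    HasSum (fun k => Real.log (ramanujanGFactor n k))
      (√n / (2 * Real.pi) * ∑' j, rowDifference √n j) := by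
  have hswap : HasSum (fun p : ℕ × ℕ => logTerm √n (p.2, p.1))
      (-(√n / (2 * Real.pi) * ∑' j, rowDifference √n j)) :=
    (Equiv.prodComm ℕ ℕ).hasSum_iff.2 (hasSum_logTerm (Real.sqrt_pos.2 hn))
  simpa only [neg_neg] using (hswap.prod_fiberwise (hasSum_logTerm_left hn)).neg

lemma ramanujanG_log {n : ℝ} (hn : 0 < n) :
    Multipliable (ramanujanGFactor n) ∧ 0 < ramanujanG n ∧
    Real.log (ramanujanG n) = -(Real.log 2 / 4) + Real.pi * √n / 24 +
      √n / (2 * Real.pi) * ∑' j, rowDifference √n j := by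
  have h := hasSum_log_ramanujanGFactor hn
  have hprod := Real.rexp_tsum_eq_tprod (ramanujanGFactor_pos hn) h.summable
  rw [h.tsum_eq] at hprod
  refine ⟨Real.multipliable_of_summable_log (ramanujanGFactor_pos hn) h.summable, ?_, ?_⟩
  · rw [ramanujanG, ← hprod]
    positivity
  · rw [ramanujanG, ← hprod, Real.log_mul (by positivity) (by positivity),
      Real.log_mul (by positivity) (by positivity), Real.log_exp, Real.log_exp,
      Real.log_rpow two_pos]
    ring

/-! ### The limit formula -/

/-- The limit for the forms `α (X² + n Y²)` and `2 α (X² + (√n / 2)² Y²)`. -/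
lemma tendsto_epsteinZeta_sub {α n : ℝ} (hα : 0 < α) (hn : 0 < n) :
    Tendsto (fun s => (GaussForm.mk α 0 (α * √n ^ 2)).epsteinZeta s -
        (GaussForm.mk (2 * α) 0 (2 * α * (√n / 2) ^ 2)).epsteinZeta s) (𝓝[>] 1)
      (𝓝 (4 * Real.pi / (α * √n) * Real.log (ramanujanG n))) := by
  rw [(ramanujanG_log hn).2.2]
  set c := √n
  have hc : 0 < c := Real.sqrt_pos.2 hn
  have hα2 : 0 < 2 * α := by positivity
  have haxis := ((tendsto_one_div_rpow hα).sub (tendsto_one_div_rpow hα2)).mul (tendsto_rowSum 0)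
  have hrem := ((tendsto_one_div_rpow hα).mul (tendsto_tsum_rowRemainder hc)).sub
    ((tendsto_one_div_rpow hα2).mul (tendsto_tsum_rowRemainder (half_pos hc)))
  have h := (haxis.add (tendsto_pole_part hα hc)).add (hrem.const_mul 2)
  convert h.congr' ?_ using 2
  · simp_rw [rowDifference]
    rw [(summable_rowRemainder hc le_rfl).tsum_sub
      ((summable_rowRemainder (half_pos hc) le_rfl).div_const 2), tsum_div_const, rowSum_one_zero]
    have := Real.pi_pos.ne'
    field_simp
    ring
  · filter_upwards [self_mem_nhdsWithin] with s hs
    rw [epsteinZeta_eq hα hc hs, epsteinZeta_eq hα2 (half_pos hc) hs]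
    ring

end KroneckerLimit

open KroneckerLimit in
/-- Kronecker's formula for `g_n`. The sums are absolutely convergent for `s > 1`, the product
defining `g_{m/A²}` converges and is positive, and the limit formula holds. -/
theorem mainTheorem4 (A C m : ℝ) (Q Q' : GaussForm)
    (hQ : Q = ⟨A, 0, 2 * C⟩) (hQ' : Q' = ⟨2 * A, 0, C⟩)
    (hpos : Q.PosDef) (hpos' : Q'.PosDef)
    (hm : Q.det = m) (hm' : Q'.det = m) :
    (∀ s : ℝ, 1 < s → Summable (Q.zetaTerm s) ∧ Summable (Q'.zetaTerm s)) ∧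
    Multipliable (ramanujanGFactor (m / A ^ 2)) ∧
    0 < ramanujanG (m / A ^ 2) ∧
    Filter.Tendsto (fun s : ℝ => Q.epsteinZeta s - Q'.epsteinZeta s)
      (nhdsWithin 1 (Set.Ioi 1))
      (nhds (4 * Real.pi / Real.sqrt m * Real.log (ramanujanG (m / A ^ 2)))) := by
  subst hQ hQ'
  obtain ⟨hA, -, hdet⟩ := hpos
  obtain ⟨-, hC, -⟩ := hpos'
  rw [hm] at hdet
  have hmAC : m = 2 * A * C := by rw [← hm, GaussForm.det]; ring
  dsimp only at hA hC
  have hn : 0 < m / A ^ 2 := by positivity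
  obtain ⟨hmult, hGpos, -⟩ := ramanujanG_log hn
  refine ⟨fun s hs => ⟨summable_zetaTerm hA (by positivity) hs,
    summable_zetaTerm (by positivity) hC hs⟩, hmult, hGpos, ?_⟩
  have h := tendsto_epsteinZeta_sub hA hn
  have h1 : A * √(m / A ^ 2) ^ 2 = 2 * C := by
    rw [Real.sq_sqrt hn.le, hmAC]; field_simp
  have h2 : 2 * A * (√(m / A ^ 2) / 2) ^ 2 = C := by
    rw [div_pow]; linarith
  have h3 : A * √(m / A ^ 2) = √m := by
    rw [Real.sqrt_div hdet.le, Real.sqrt_sq hA.le]; field_simp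
  rwa [h1, h2, h3] at h
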